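/- Let $K_n$ be the complete graph on $n$ labelled vertices. A subtree of $K_n$ is a subgraph of $K_n$ (a vertex set together with an edge set) that is a tree; only subtrees with at least one edge are considered. For $k \ge 1$ let $a_k = a_k(n)$ be the number of subtrees of $K_n$ with exactly $k$ edges, and for $n \ge 2$ put $$\mu_p(n)=\frac{\sum_{k=1}^{n-1}k\,a_k}{(n-1)\sum_{k=1}^{n-1}a_k},\qquad \mu_q(n)=\frac{\sum_{k=1}^{n-1}k^2a_k}{(n-1)\sum_{k=1}^{n-1}k\,a_k}.$$ For every $n\ge 2$, $\mu_p(n)$ and $\mu_q(n)$ are the expected number of edges $\sum_T \mathrm{pr}(T)\,|E(T)|$ of a random subtree $T$ of $K_n$, divided by $n-1$: for $\mu_p$ all subtrees are equally likely, and for $\mu_q$ the probability $\mathrm{pr}(T)$ is proportional to the number $|E(T)|$ of edges of $T$. Moreover, $$\lim_{n\to\infty}\mu_p(n)=1\qquad\text{and}\qquad \lim_{n\to\infty}\mu_q(n)=1 .$$ -/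

import Mathlib

open Filter Topology

noncomputable section

namespace RandomSubtree

open Classical in
/-- The subtrees of a finite graph `G` that have at least one edge. A subtree is a subgraph
(a set of vertices together with a set of edges) which is a tree. -/
def subtrees {V : Type*} [Fintype V] (G : SimpleGraph V) : Finset G.Subgraph :=
  Finset.univ.filter fun T => T.coe.IsTree ∧ T.edgeSet.Nonempty

/-- The number of edges of a subgraph. -/
def size {V : Type*} {G : SimpleGraph V} (T : G.Subgraph) : ℕ :=
  T.edgeSet.ncard

/-- The complete graph `K_n` on `n` labelled vertices. -/
abbrev K (n : ℕ) : SimpleGraph (Fin n) := ⊤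

/-- `a n k` is the number of subtrees of `K_n` with exactly `k` edges, for `k ≥ 1`. -/
def a (n k : ℕ) : ℕ :=
  ((subtrees (K n)).filter fun T => size T = k).card

/-- The uniform probability of a subtree `T` of `G`: all subtrees are equally likely. -/
def uniformProb {V : Type*} [Fintype V] (G : SimpleGraph V) (_T : G.Subgraph) : ℝ :=
  1 / (subtrees G).card

/-- The weighted probability of a subtree `T` of `G`: proportional to its number of edges. -/
def weightedProb {V : Type*} [Fintype V] (G : SimpleGraph V) (T : G.Subgraph) : ℝ :=
  size T / ∑ S ∈ subtrees G, (size S : ℝ)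

/-- The expected number of edges of a random subtree of `G`, when the subtree `T` is
selected with probability `pr T`. -/
def expectedSize {V : Type*} [Fintype V] (G : SimpleGraph V) (pr : G.Subgraph → ℝ) : ℝ :=
  ∑ T ∈ subtrees G, pr T * size T

/-- The uniform subtree density of `K_n`. -/
def uniformDensity (n : ℕ) : ℝ :=
  (∑ k ∈ Finset.Icc 1 (n - 1), (k : ℝ) * a n k) /
    (((n : ℝ) - 1) * ∑ k ∈ Finset.Icc 1 (n - 1), (a n k : ℝ))

/-- The weighted subtree density of `K_n`. -/
def weightedDensity (n : ℕ) : ℝ :=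
  (∑ k ∈ Finset.Icc 1 (n - 1), (k : ℝ) ^ 2 * a n k) /
    (((n : ℝ) - 1) * ∑ k ∈ Finset.Icc 1 (n - 1), (k : ℝ) * a n k)

end RandomSubtree

end

namespace RandomSubtree

/-! Almost all subtrees are nearly spanning, because small trees extend in many ways. Joining a
vertex `v` of a `k`-edge tree to a vertex `w` outside it gives a tree with `k + 1` edges and a
marked leaf `w`, from which the tree and `v` can be recovered. Counting gives `(k + 1) (n - 1 - k)
a_k ≤ (k + 2) a_{k+1}` (`succ_mul_a_le`), hence `(n - 1 - k) a_k ≤ 2 a_{k+1}`. Summed over `k`, this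
bounds the mean of `n - 1 - k` by 2, so `1 - 2 / (n - 1) ≤ μ_p ≤ 1`. The weights `k a_k` satisfy the
same recursive inequality, so `μ_q` obeys the same bounds (`one_sub_two_div_le`). -/

/-- Replaces the tree condition on `T.coe` by counts on `T` itself, which are easy to follow when an
edge is attached. -/
theorem mem_subtrees_iff {V : Type*} [Fintype V] {G : SimpleGraph V}
    (T : G.Subgraph) :
    T ∈ subtrees G ↔ T.Connected ∧ size T + 1 = T.verts.ncard ∧ 1 ≤ size T := by
  have hcard : Nat.card T.coe.edgeSet = size T := by
    rw [size, ← SimpleGraph.Subgraph.image_coe_edgeSet_coe, Set.ncard_image_of_injective _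
      (Sym2.map.injective Subtype.val_injective), Nat.card_coe_set_eq]
  have hpos : 1 ≤ size T ↔ T.edgeSet.Nonempty := by
    rw [size, Nat.one_le_iff_ne_zero, Set.nonempty_iff_ne_empty, Ne, Set.ncard_eq_zero]
  simp only [subtrees, Finset.mem_filter, Finset.mem_univ, true_and]
  rw [ SimpleGraph.isTree_iff_connected_and_card, hcard, hpos,
    SimpleGraph.Subgraph.connected_iff', Nat.card_coe_set_eq, and_assoc]

/-- The subgraph obtained from `T` by attaching the edge from `v` to `w`. -/
def attach {n : ℕ} (T : (K n).Subgraph) {v w : Fin n} (h : v ≠ w) : (K n).Subgraph :=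
  T ⊔ (K n).subgraphOfAdj (show (K n).Adj v w from h)

variable {n : ℕ} {T : (K n).Subgraph} {v w : Fin n}

theorem verts_attach (h : v ≠ w) (hv : v ∈ T.verts) :
    (attach T h).verts = insert w T.verts := by
  ext x
  simp only [attach, SimpleGraph.Subgraph.verts_sup, SimpleGraph.subgraphOfAdj_verts,
    Set.mem_union, Set.mem_insert_iff, Set.mem_singleton_iff]
  grind

theorem adj_attach (h : v ≠ w) (x y : Fin n) :
    (attach T h).Adj x y ↔ T.Adj x y ∨ s(v, w) = s(x, y) := by
  simp [attach]

theorem size_attach (h : v ≠ w) (hw : w ∉ T.verts) : size (attach T h) = size T + 1 := by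
  rw [size, attach, SimpleGraph.Subgraph.edgeSet_sup, SimpleGraph.edgeSet_subgraphOfAdj,
    Set.union_singleton, Set.ncard_insert_of_notMem _ (Set.toFinite _), size]
  exact fun he => hw (T.edge_vert (SimpleGraph.Subgraph.mem_edgeSet.1 he).symm)

theorem attach_mem_subtrees (hT : T ∈ subtrees (K n)) (h : v ≠ w) (hv : v ∈ T.verts)
    (hw : w ∉ T.verts) : attach T h ∈ subtrees (K n) := by
  rw [mem_subtrees_iff] at hT ⊢
  obtain ⟨hc, hs, hp⟩ := hT
  refine ⟨?_, ?_, ?_⟩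
  · exact SimpleGraph.Subgraph.connected_sup hc.preconnected
      (SimpleGraph.Subgraph.subgraphOfAdj_connected _).preconnected ⟨v, hv, by simp⟩
  · rw [size_attach h hw, verts_attach h hv, Set.ncard_insert_of_notMem hw (Set.toFinite _), hs]
  · rw [size_attach h hw]; omega

/-- Deleting the leaf `w` gives back the tree, and `v` is the only neighbour of `w`. -/
theorem attach_injective {T' : (K n).Subgraph} {v' : Fin n} (h : v ≠ w) (h' : v' ≠ w)
    (hv : v ∈ T.verts) (hw : w ∉ T.verts) (hv' : v' ∈ T'.verts) (hw' : w ∉ T'.verts)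
    (he : attach T h = attach T' h') : T = T' ∧ v = v' := by
  have hverts : insert w T.verts = insert w T'.verts := by
    rw [← verts_attach h hv, ← verts_attach h' hv', he]
  have hadj : ∀ x y, (T.Adj x y ∨ s(v, w) = s(x, y)) ↔ (T'.Adj x y ∨ s(v', w) = s(x, y)) := by
    intro x y
    rw [← adj_attach h, ← adj_attach h', he]
  have hne : ∀ {S : (K n).Subgraph}, w ∉ S.verts → ∀ {x y}, S.Adj x y → x ≠ w ∧ y ≠ w :=
    fun {S} hS _ _ hxy =>
      ⟨fun e => hS (e ▸ S.edge_vert hxy), fun e => hS (e ▸ S.edge_vert hxy.symm)⟩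
  refine ⟨SimpleGraph.Subgraph.ext ?_ ?_, ?_⟩
  · ext x
    have := Set.ext_iff.1 hverts x
    simp only [Set.mem_insert_iff] at this
    grind
  · ext x y
    have := hadj x y
    simp only [Sym2.eq_iff] at this
    constructor
    · intro hxy
      have := hne hw hxy
      grind
    · intro hxy
      have := hne hw' hxy
      grind
  · rcases (hadj v w).1 (Or.inr rfl) with hT' | he
    · exact absurd rfl (hne hw' hT').2
    · simp only [Sym2.eq_iff] at he
      grind

theorem size_mem_Icc (hT : T ∈ subtrees (K n)) : size T ∈ Finset.Icc 1 (n - 1) := by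
  obtain ⟨-, hs, hp⟩ := (mem_subtrees_iff T).1 hT
  have : T.verts.ncard ≤ n := by
    simpa using Set.ncard_le_card T.verts
  rw [Finset.mem_Icc]
  omega

open Classical in
theorem succ_mul_a_le (n k : ℕ) :
    (k + 1) * (n - (k + 1)) * a n k ≤ (k + 2) * a n (k + 1) := by
  let level (k : ℕ) := (subtrees (K n)).filter fun T => size T = k
  have hcard : ∀ {k}, ∀ T ∈ level k, T.verts.toFinset.card = k + 1 := by
    intro k T hT
    obtain ⟨hT, hs⟩ := Finset.mem_filter.1 hT
    rw [← Set.ncard_eq_toFinset_card', ← ((mem_subtrees_iff T).1 hT).2.1, hs]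
  let source := (level k).sigma fun T => T.verts.toFinset ×ˢ T.verts.toFinsetᶜ
  let target := (level (k + 1)).sigma fun T => T.verts.toFinset
  have hsource : source.card = (k + 1) * (n - (k + 1)) * a n k := by
    rw [Finset.card_sigma, Finset.sum_congr rfl (g := fun _ => (k + 1) * (n - (k + 1))),
      Finset.sum_const, smul_eq_mul, mul_comm]
    · rfl
    · intro T hT
      rw [Finset.card_product, Finset.card_compl, hcard T hT, Fintype.card_fin]
  have htarget : target.card = (k + 2) * a n (k + 1) := by
    rw [Finset.card_sigma, Finset.sum_congr rfl hcard, Finset.sum_const, smul_eq_mul, mul_comm]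
    rfl
  -- The target allows any vertex of the larger tree as the mark, not only a leaf; this loses little
  -- and needs no count of leaves.
  rw [← hsource, ← htarget]
  have hmem : ∀ x ∈ source, x.1 ∈ subtrees (K n) ∧ size x.1 = k ∧ x.2.1 ∈ x.1.verts ∧
      x.2.2 ∉ x.1.verts := by
    rintro ⟨T, v, w⟩ hx
    simpa [source, level, and_assoc] using hx
  have hne : ∀ x ∈ source, x.2.1 ≠ x.2.2 := fun x hx e =>
    (hmem x hx).2.2.2 (e ▸ (hmem x hx).2.2.1)
  refine Finset.card_le_card_of_injOn
    -- The second branch is a dummy value, never reached on `source`.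
    (fun x => if h : x.2.1 ≠ x.2.2 then ⟨attach x.1 h, x.2.2⟩ else ⟨x.1, x.2.2⟩) ?_ ?_
  · intro x hx
    obtain ⟨hT, hs, hv, hw⟩ := hmem x hx
    simp only [dif_pos (hne x hx)]
    rw [Finset.mem_coe, Finset.mem_sigma]
    refine ⟨Finset.mem_filter.2 ⟨attach_mem_subtrees hT (hne x hx) hv hw, ?_⟩, ?_⟩
    · rw [size_attach (hne x hx) hw, hs]
    · simp [verts_attach (hne x hx) hv]
  · rintro ⟨T, v, w⟩ hx ⟨T', v', w'⟩ hx' he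
    obtain ⟨-, -, hv, hw⟩ := hmem _ hx
    obtain ⟨-, -, hv', hw'⟩ := hmem _ hx'
    simp only [dif_pos (hne _ hx), dif_pos (hne _ hx')] at he
    rw [Sigma.mk.injEq] at he
    obtain ⟨he, hww⟩ := he
    obtain rfl : w = w' := eq_of_heq hww
    obtain ⟨rfl, rfl⟩ := attach_injective _ _ hv hw hv' hw' he
    rfl

theorem sub_mul_a_le {n k : ℕ} (hk : k < n - 1) :
    (((n - 1 : ℕ) : ℝ) - k) * a n k ≤ 2 * a n (k + 1) := by
  have h : ((k + 1) * (n - (k + 1)) * a n k : ℝ) ≤ (k + 2) * a n (k + 1) := by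
    have := succ_mul_a_le n k
    rify [show k + 1 ≤ n by omega] at this
    exact this
  have h1 : (1 : ℕ) ≤ n := by omega
  push_cast [h1]
  have hk0 : (0 : ℝ) < k + 1 := by positivity
  refine le_of_mul_le_mul_left ?_ hk0
  -- This is the slack in `k + 2 ≤ 2 (k + 1)`.
  have : (0 : ℝ) ≤ k * a n (k + 1) := by positivity
  linarith

/-- Adding the nonnegative term `k = 0` and dropping the zero term `k = m` makes the shift `k ↦ k +
1` land exactly on `1, …, m`. -/
theorem sum_sub_mul_le {m : ℕ} {c : ℕ → ℝ} (hc : ∀ k, 0 ≤ c k)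
    (h : ∀ k < m, ((m : ℝ) - k) * c k ≤ 2 * c (k + 1)) :
    ∑ k ∈ Finset.Icc 1 m, ((m : ℝ) - k) * c k ≤ 2 * ∑ k ∈ Finset.Icc 1 m, c k := by
  calc ∑ k ∈ Finset.Icc 1 m, ((m : ℝ) - k) * c k
      ≤ ∑ k ∈ Finset.range (m + 1), ((m : ℝ) - k) * c k := by
        refine Finset.sum_le_sum_of_subset_of_nonneg ?_ ?_
        · intro k; simp
        · intro k hk _
          have : (k : ℝ) ≤ m := by exact_mod_cast Finset.mem_range_succ_iff.1 hk
          exact mul_nonneg (by linarith) (hc k)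
    _ = ∑ k ∈ Finset.range m, ((m : ℝ) - k) * c k := by simp [Finset.sum_range_succ]
    _ ≤ ∑ k ∈ Finset.range m, 2 * c (k + 1) :=
        Finset.sum_le_sum fun k hk => h k (Finset.mem_range.1 hk)
    _ = 2 * ∑ k ∈ Finset.Icc 1 m, c k := by
        rw [← Finset.mul_sum, Finset.range_eq_Ico, Finset.sum_Ico_add' c 0 m 1]
        rfl

theorem one_sub_two_div_le {m : ℕ} (hm : 1 ≤ m) {c : ℕ → ℝ} (hc : ∀ k, 0 ≤ c k)
    (hpos : 0 < c 1) (h : ∀ k < m, ((m : ℝ) - k) * c k ≤ 2 * c (k + 1)) :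
    1 - 2 / (m : ℝ) ≤
        (∑ k ∈ Finset.Icc 1 m, (k : ℝ) * c k) / (m * ∑ k ∈ Finset.Icc 1 m, c k) ∧
      (∑ k ∈ Finset.Icc 1 m, (k : ℝ) * c k) / (m * ∑ k ∈ Finset.Icc 1 m, c k) ≤ 1 := by
  have hm0 : (0 : ℝ) < m := by exact_mod_cast hm
  have hs : 0 < ∑ k ∈ Finset.Icc 1 m, c k :=
    hpos.trans_le (Finset.single_le_sum (fun k _ => hc k) (by simpa using hm))
  have hsum := sum_sub_mul_le hc h
  simp only [sub_mul, Finset.sum_sub_distrib, ← Finset.mul_sum] at hsum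
  constructor
  · rw [le_div_iff₀ (by positivity)]
    field_simp
    linarith
  · rw [div_le_one (by positivity), Finset.mul_sum]
    refine Finset.sum_le_sum fun k hk => mul_le_mul_of_nonneg_right ?_ (hc k)
    exact_mod_cast (Finset.mem_Icc.1 hk).2

theorem a_one_pos {n : ℕ} (hn : 2 ≤ n) : 0 < a n 1 := by
  have h : (K n).Adj ⟨0, by omega⟩ ⟨1, by omega⟩ := by simp
  have hs : size ((K n).subgraphOfAdj h) = 1 := by simp [size]
  refine Finset.card_pos.2 ⟨(K n).subgraphOfAdj h, Finset.mem_filter.2 ⟨?_, hs⟩⟩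
  rw [mem_subtrees_iff, hs]
  refine ⟨SimpleGraph.Subgraph.subgraphOfAdj_connected h, ?_, le_rfl⟩
  rw [SimpleGraph.subgraphOfAdj_verts, Set.ncard_pair h.ne]

theorem sum_subtrees_eq (n : ℕ) (f : ℕ → ℝ) :
    ∑ T ∈ subtrees (K n), f (size T) = ∑ k ∈ Finset.Icc 1 (n - 1), f k * a n k := by
  rw [← Finset.sum_fiberwise_of_maps_to (fun T hT => size_mem_Icc hT)]
  refine Finset.sum_congr rfl fun k _ => ?_
  rw [Finset.sum_congr rfl (g := fun _ => f k) fun T hT => by rw [(Finset.mem_filter.1 hT).2],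
    Finset.sum_const, nsmul_eq_mul, mul_comm]
  rfl

theorem expectedSize_uniformProb_div (n : ℕ) :
    expectedSize (K n) (uniformProb (K n)) / ((n : ℝ) - 1) = uniformDensity n := by
  have h1 := sum_subtrees_eq n fun _ => 1
  have h2 := sum_subtrees_eq n fun k => k
  simp only [Finset.sum_const, nsmul_eq_mul, mul_one, one_mul] at h1
  rw [expectedSize, uniformDensity, ← h1, ← h2]
  simp only [uniformProb, ← Finset.mul_sum]
  rw [one_div_mul_eq_div, div_div, mul_comm]

theorem expectedSize_weightedProb_div (n : ℕ) :
    expectedSize (K n) (weightedProb (K n)) / ((n : ℝ) - 1) = weightedDensity n := by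
  have h1 := sum_subtrees_eq n fun k => k
  have h2 := sum_subtrees_eq n fun k => (k : ℝ) ^ 2
  rw [expectedSize, weightedDensity, ← h1, ← h2]
  simp only [weightedProb, div_mul_eq_mul_div, ← Finset.sum_div, ← pow_two]
  rw [div_div, mul_comm]

theorem tendsto_one_of_bounds {d : ℕ → ℝ}
    (h : ∀ n, 2 ≤ n → 1 - 2 / ((n - 1 : ℕ) : ℝ) ≤ d n ∧ d n ≤ 1) :
    Tendsto d atTop (𝓝 1) := by
  have hlim : Tendsto (fun n : ℕ => 1 - 2 / ((n - 1 : ℕ) : ℝ)) atTop (𝓝 1) := by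
    have := ((tendsto_const_div_atTop_nhds_zero_nat (2 : ℝ)).comp
      (tendsto_sub_atTop_nat 1)).const_sub 1
    simpa [Function.comp_def] using this
  refine tendsto_of_tendsto_of_tendsto_of_le_of_le' hlim tendsto_const_nhds ?_ ?_
  · filter_upwards [eventually_ge_atTop 2] with n hn using (h n hn).1
  · filter_upwards [eventually_ge_atTop 2] with n hn using (h n hn).2

theorem tendsto_uniformDensity : Tendsto uniformDensity atTop (𝓝 1) := by
  refine tendsto_one_of_bounds fun n hn => ?_
  have := one_sub_two_div_le (m := n - 1) (c := fun k => a n k) (by omega)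
    (fun k => by positivity) (by exact_mod_cast a_one_pos hn) (fun k hk => sub_mul_a_le hk)
  have hcast : ((n - 1 : ℕ) : ℝ) = (n : ℝ) - 1 := by push_cast [show 1 ≤ n by omega]; rfl
  rw [uniformDensity, ← hcast]
  exact this

theorem tendsto_weightedDensity : Tendsto weightedDensity atTop (𝓝 1) := by
  refine tendsto_one_of_bounds fun n hn => ?_
  have := one_sub_two_div_le (m := n - 1) (c := fun k => (k : ℝ) * a n k) (by omega)
    (fun k => by positivity) (by simpa using a_one_pos hn) (fun k hk => by
      -- The extra factor `k` is harmless, as `2 k a_{k+1} ≤ 2 (k + 1) a_{k+1}`.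
      have h1 := mul_le_mul_of_nonneg_left (sub_mul_a_le hk) (Nat.cast_nonneg (α := ℝ) k)
      have h2 : (0 : ℝ) ≤ a n (k + 1) := by positivity
      push_cast
      linarith)
  have hcast : ((n - 1 : ℕ) : ℝ) = (n : ℝ) - 1 := by push_cast [show 1 ≤ n by omega]; rfl
  rw [weightedDensity, ← hcast]
  simpa only [pow_two, mul_assoc] using this

end RandomSubtree

theorem theorem2 :
    (∀ n : ℕ, 2 ≤ n →
      RandomSubtree.expectedSize (RandomSubtree.K n)
          (RandomSubtree.uniformProb (RandomSubtree.K n)) / ((n : ℝ) - 1) =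
        RandomSubtree.uniformDensity n ∧
      RandomSubtree.expectedSize (RandomSubtree.K n)
          (RandomSubtree.weightedProb (RandomSubtree.K n)) / ((n : ℝ) - 1) =
        RandomSubtree.weightedDensity n) ∧
    Tendsto RandomSubtree.uniformDensity atTop (𝓝 1) ∧
    Tendsto RandomSubtree.weightedDensity atTop (𝓝 1) := by
  exact ⟨fun n _ => ⟨RandomSubtree.expectedSize_uniformProb_div n,
      RandomSubtree.expectedSize_weightedProb_div n⟩,
    RandomSubtree.tendsto_uniformDensity, RandomSubtree.tendsto_weightedDensity⟩
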